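/- A digraph is a set $A$ with an arbitrary binary relation $E$ on $A$, viewed as a first-order structure $\mathcal A=(A,E)$. A kernel of $\mathcal A$ is a set $K\subseteq A$ such that for every $a\in A$: $a\in K$ if and only if $b\notin K$ whenever $aEb$. For $X\subseteq A$ put $\mathrm{Cl}_0(X)=X$ and $\mathrm{Cl}_{k+1}(X)=X\cup\{a\in A: dEa\text{ for some }d\in \mathrm{Cl}_k(X)\}$. A digraph has finite height if for some $k<\omega$ it has no directed walk with $k+1$ edges; its height is then the least such $k$. The digraph $\mathcal A$ has local finite height if for every $m<\omega$ there is $k<\omega$ such that, for every $F\subseteq A$ with at most $m$ elements, the subdigraph induced on $\mathrm{Cl}_m(F)$ has finite height at most $k$. A structure $\mathcal M$ is resplendent if, for every first-order sentence $\varphi$ with parameters from $M$ and finitely many new relation symbols, whenever some elementary extension of $\mathcal M$ can be expanded to a model of $\varphi$, then $\mathcal M$ itself can be expanded to a model of $\varphi$. A digraph $\mathcal A$ is recursively saturated if, for every $m<\omega$, every finite tuple $\bar a\in A^m$ and every recursive set $p(x,\bar y)$ of first-order formulas in the language $\{E\}$ with free variables among $x,y_1,\dots,y_m$, whenever every finite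 subset of $p(x,\bar a)$ is satisfied by an element of $\mathcal A$, then some element of $\mathcal A$ satisfies all of $p(x,\bar a)$. Let $\mathcal A$ be a digraph that has local finite height. (1) If $\mathcal A$ is resplendent, then $\mathcal A$ has a kernel. (2) If $\mathcal A$ is countable and recursively saturated, then $\mathcal A$ has a kernel. -/

import Mathlib

open FirstOrder

universe u

namespace DigraphKernel

/-! ### Kernels and local finite height -/

section Digraphs

variable {V : Type u}

/-- `K` is a kernel of `G`: a vertex `a` lies in `K` iff no out-neighbour of `a` lies in `K`. -/
def IsKernel (G : Digraph V) (K : Set V) : Prop :=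
  ∀ a, a ∈ K ↔ ∀ b, G.Adj a b → b ∉ K

/-- `edgePow G n x y`: there is a directed walk with exactly `n` edges from `x` to `y`. -/
def edgePow (G : Digraph V) : ℕ → V → V → Prop
  | 0, x, y => x = y
  | n + 1, x, y => ∃ z, G.Adj x z ∧ edgePow G n z y

/-- The subdigraph of `G` induced on the set `B` of vertices. -/
def induced (G : Digraph V) (B : Set V) : Digraph B where
  Adj x y := G.Adj x y

/-- `clStep G X k` is the set of vertices reachable from `X` by a directed walk
with at most `k` edges. -/
def clStep (G : Digraph V) (X : Set V) : ℕ → Set V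
  | 0 => X
  | k + 1 => X ∪ {a | ∃ d ∈ clStep G X k, G.Adj d a}

/-- `G` has finite height: for some `k` there is no directed walk with `k + 1` edges. -/
def HasFiniteHeight (G : Digraph V) : Prop :=
  ∃ k : ℕ, ¬ ∃ a b, edgePow G (k + 1) a b

/-- The height: the least `k` for which there is no directed walk with `k + 1` edges
(meaningful only if `HasFiniteHeight G`). -/
noncomputable def height (G : Digraph V) : ℕ :=
  sInf {k : ℕ | ¬ ∃ a b, edgePow G (k + 1) a b}

/-- `G` has local finite height: for every `m` there is a `k` that bounds the height of the
subdigraph induced on `clStep G F m`, for all `F` with at most `m` elements. -/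
def HasLocalFiniteHeight (G : Digraph V) : Prop :=
  ∀ m : ℕ, ∃ k : ℕ, ∀ F : Finset V, F.card ≤ m →
    HasFiniteHeight (induced G (clStep G (F : Set V) m)) ∧
      height (induced G (clStep G (F : Set V) m)) ≤ k

end Digraphs

/-! ### Resplendent structures -/

/-- The language with finitely many relation symbols, the `i`-th of arity `ar i`,
and no function symbols. -/
def relLanguage {n : ℕ} (ar : Fin n → ℕ) : FirstOrder.Language.{0, 0} where
  Functions _ := Empty
  Relations k := {i : Fin n // ar i = k}

/-- An `L`-structure `M` is resplendent: for every first-order sentence `φ` with parameters in `M`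
and finitely many new relation symbols, if some elementary extension of `M` can be
expanded to a model of `φ`, then `M` itself can be expanded to a model of `φ`.
The parameters are the free variables of `φ`, which are interpreted by their images in the
elementary extension and by themselves in `M`. -/
def IsResplendent (L : FirstOrder.Language.{0, 0}) (M : Type u) [L.Structure M] : Prop :=
  ∀ (n : ℕ) (ar : Fin n → ℕ) (φ : (L.sum (relLanguage ar)).Formula M),
    (∃ (N : Type u) (_ : L.Structure N) (f : M ↪ₑ[L] N) (_ : (relLanguage ar).Structure N),
      φ.Realize (f : M → N)) →
    ∃ _ : (relLanguage ar).Structure M, φ.Realize (id : M → M)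

/-- A digraph as a first-order structure in the language with one binary relation symbol. -/
@[reducible]
def toStructure {V : Type u} (G : Digraph V) : FirstOrder.Language.graph.Structure V where
  RelMap | .adj => fun x => G.Adj (x 0) (x 1)

/-- A digraph is resplendent if it is so as a first-order structure. -/
def Resplendent {V : Type u} (G : Digraph V) : Prop :=
  @IsResplendent FirstOrder.Language.graph V (toStructure G)

/-! ### Recursively saturated digraphs -/

/-- Gödel numbers of terms (that is, of variables) in the language of digraphs. -/
def termCode {m n : ℕ} : FirstOrder.Language.graph.Term (Fin m ⊕ Fin n) → ℕ
  | .var (Sum.inl i) => 2 * (i : ℕ)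
  | .var (Sum.inr j) => 2 * (j : ℕ) + 1
  | .func f _ => isEmptyElim f

/-- Gödel numbers of formulas in the language of digraphs. For fixed `m` and `n` this map is
injective. -/
def formulaCode {m : ℕ} : {n : ℕ} → FirstOrder.Language.graph.BoundedFormula (Fin m) n → ℕ
  | _, .falsum => 0
  | _, .equal t₁ t₂ => 4 * Nat.pair (termCode t₁) (termCode t₂) + 1
  | _, .rel .adj ts => 4 * Nat.pair (termCode (ts 0)) (termCode (ts 1)) + 2
  | _, .imp φ ψ => 4 * Nat.pair (formulaCode φ) (formulaCode ψ) + 3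
  | _, .all φ => 4 * formulaCode φ + 4

/-- A set of formulas is recursive if the set of its Gödel numbers is computable. -/
def RecursiveSet {m : ℕ} (p : Set (FirstOrder.Language.graph.Formula (Fin m))) : Prop :=
  ComputablePred fun c : ℕ => ∃ φ ∈ p, formulaCode φ = c

/-- `G` is recursively saturated: for every tuple `a` of parameters, each recursive set `p` of
formulas `φ(x, y₁, …, yₘ)` such that `p(x, a)` is finitely satisfiable in `G` is realized in `G`.
Variable `0` is `x` and variables `1, …, m` are `y₁, …, yₘ`. -/
def RecursivelySaturated {V : Type u} (G : Digraph V) : Prop :=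
  letI := toStructure G
  ∀ (m : ℕ) (a : Fin m → V) (p : Set (FirstOrder.Language.graph.Formula (Fin (m + 1)))),
    RecursiveSet p →
    (∀ s : Finset (FirstOrder.Language.graph.Formula (Fin (m + 1))), (s : Set _) ⊆ p →
      ∃ x : V, ∀ φ ∈ s, φ.Realize (Fin.cons x a : Fin (m + 1) → V)) →
    ∃ x : V, ∀ φ ∈ p, φ.Realize (Fin.cons x a : Fin (m + 1) → V)

end DigraphKernel

/-! A kernel can be built one vertex at a time: each vertex `x` is challenged in turn and answered
by declaring `x` or an out-neighbour of `x` to lie in the kernel, never both ends of an edge. Once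
every vertex has been challenged, the declared vertices form a kernel. The point is that the player
need never get trapped.

Local finite height settles games of finite length. It bounds how far membership at one vertex
depends on others, so a partial kernel around a finite set extends to one around a larger finite set
without change on the old one (`exists_isKernelOn_extension`). Induction on the number of rounds
gives `not_lost_empty`.

That the opponent wins within `n` rounds is expressible in first-order logic, so an answer good for
all `n` is a realization of a type, finitely satisfiable as long as the current position is not
lost. This type is recursive, hence realized under recursive saturation; a countable digraph then
gets its kernel by running through an enumeration.

For a resplendent digraph it is enough that some elementary extension has a kernel. An ultrapower
over `ℕ` realizes the types but need not be countable, so the game is played in countable elementary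
substructures closed under a strategy. An ultraproduct of these, indexed by the finite sets of
vertices, is an elementary extension of the original digraph and inherits a kernel. -/

namespace DigraphKernel

/-! ### Extending partial kernels under local finite height -/

section Combinatorics

variable {V : Type u}

theorem subset_clStep (G : Digraph V) (X : Set V) : ∀ k, X ⊆ clStep G X k
  | 0 => subset_rfl
  | _ + 1 => Set.subset_union_left

theorem clStep_succ_of_adj {G : Digraph V} {X : Set V} {k : ℕ} {d a : V}
    (hd : d ∈ clStep G X k) (h : G.Adj d a) : a ∈ clStep G X (k + 1) :=
  Or.inr ⟨d, hd, h⟩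

theorem clStep_subset_succ (G : Digraph V) (X : Set V) :
    ∀ k, clStep G X k ⊆ clStep G X (k + 1)
  | 0 => Set.subset_union_left
  | k + 1 => by
    rintro a (ha | ⟨d, hd, h⟩)
    · exact Or.inl ha
    · exact Or.inr ⟨d, clStep_subset_succ G X k hd, h⟩

theorem clStep_monotone (G : Digraph V) (X : Set V) : Monotone (clStep G X) :=
  monotone_nat_of_le_succ (clStep_subset_succ G X)

theorem clStep_mono {G : Digraph V} {X Y : Set V} (h : X ⊆ Y) :
    ∀ k, clStep G X k ⊆ clStep G Y k
  | 0 => h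
  | k + 1 => by
    rintro a (ha | ⟨d, hd, h'⟩)
    · exact Or.inl (h ha)
    · exact Or.inr ⟨d, clStep_mono h k hd, h'⟩

theorem clStep_subset_clStep_succ {G : Digraph V} {X Y : Set V} (h : X ⊆ clStep G Y 1) :
    ∀ k, clStep G X k ⊆ clStep G Y (k + 1)
  | 0 => h
  | k + 1 => by
    rintro a (ha | ⟨d, hd, h'⟩)
    · exact clStep_monotone G Y (by omega) (h ha)
    · exact Or.inr ⟨d, clStep_subset_clStep_succ h k hd, h'⟩

theorem clStep_empty (G : Digraph V) : ∀ k, clStep G ∅ k = ∅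
  | 0 => rfl
  | k + 1 => by simp [clStep, clStep_empty G k]

theorem mem_clStep_add_of_edgePow {G : Digraph V} {X : Set V} :
    ∀ {n k : ℕ} {a b : V}, a ∈ clStep G X k → edgePow G n a b → b ∈ clStep G X (k + n)
  | 0, _, _, _, ha, rfl => ha
  | n + 1, k, _, _, ha, ⟨z, hz, h⟩ => by
    have := mem_clStep_add_of_edgePow (clStep_succ_of_adj ha hz) h
    rwa [Nat.add_assoc, Nat.add_comm 1 n] at this

theorem edgePow_induced {G : Digraph V} {B : Set V} :
    ∀ {n : ℕ} {a b : B}, edgePow (induced G B) n a b → edgePow G n (a : V) b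
  | 0, _, _, h => congrArg Subtype.val h
  | _ + 1, _, _, ⟨z, hz, h⟩ => ⟨z, hz, edgePow_induced h⟩

theorem edgePow_succ_right {G : Digraph V} :
    ∀ {n : ℕ} {a b c : V}, edgePow G n a b → G.Adj b c → edgePow G (n + 1) a c
  | 0, _, _, c, rfl, h => ⟨c, h, rfl⟩
  | _ + 1, _, _, _, ⟨z, hz, h⟩, h' => ⟨z, hz, edgePow_succ_right h h'⟩

theorem exists_edgePow_of_le {G : Digraph V} :
    ∀ {m n : ℕ} {a b : V}, m ≤ n → edgePow G n a b → ∃ c, edgePow G m a c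
  | 0, _, a, _, _, _ => ⟨a, rfl⟩
  | m + 1, n + 1, _, _, h, ⟨z, hz, hw⟩ => by
    obtain ⟨c, hc⟩ := exists_edgePow_of_le (Nat.le_of_succ_le_succ h) hw
    exact ⟨c, z, hz, hc⟩

theorem not_edgePow_of_height_le {G : Digraph V} {k n : ℕ} (hG : HasFiniteHeight G)
    (hk : height G ≤ k) (hn : k < n) (a b : V) : ¬ edgePow G n a b := by
  have h : ¬ ∃ a b, edgePow G (height G + 1) a b := Nat.sInf_mem hG
  intro hab
  obtain ⟨c, hc⟩ := exists_edgePow_of_le (m := height G + 1) (by omega) hab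
  exact h ⟨a, c, hc⟩

theorem acc_of_not_edgePow {G : Digraph V} :
    ∀ {n : ℕ} {a : V}, (∀ b, ¬ edgePow G n a b) → Acc (fun x y => G.Adj y x) a
  | 0, a, h => (h a rfl).elim
  | _ + 1, _, h => ⟨_, fun y hy => acc_of_not_edgePow fun b hb => h b ⟨y, hy, hb⟩⟩

/-- Along a well-founded relation, a set can be prescribed arbitrarily on `C` and is then
extended to the complement of `C` by the kernel condition. -/
theorem exists_kernel_extending {r : V → V → Prop} (hr : WellFounded r) (C U : Set V) :
    ∃ K : Set V, (∀ a ∈ C, a ∈ K ↔ a ∈ U) ∧ ∀ a ∉ C, a ∈ K ↔ ∀ b, r b a → b ∉ K := by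
  classical
  let F : (a : V) → ((b : V) → r b a → Prop) → Prop :=
    fun a f => if a ∈ C then a ∈ U else ∀ b (h : r b a), ¬ f b h
  refine ⟨{a | hr.fix F a}, fun a ha => ?_, fun a ha => ?_⟩
  · change hr.fix F a ↔ _
    rw [hr.fix_eq]; simp [F, ha]
  · change hr.fix F a ↔ ∀ b, r b a → ¬ hr.fix F b
    rw [hr.fix_eq]; simp [F, ha]

/-- `U` satisfies the kernel condition at each vertex of `X`. -/
def IsKernelOn (G : Digraph V) (X U : Set V) : Prop :=
  ∀ a ∈ X, a ∈ U ↔ ∀ b, G.Adj a b → b ∉ U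

theorem IsKernelOn.mono {G : Digraph V} {X Y U : Set V} (h : IsKernelOn G Y U) (hXY : X ⊆ Y) :
    IsKernelOn G X U := fun a ha => h a (hXY ha)

/-- Keep `U` on everything reachable from `F` inside a large enough closure of `F'`, and define the
rest by well-founded recursion along edges. The bound on heights confines the reachable part to a
closure of `F` whose depth `l` depends on `m` and `k` only. -/
theorem exists_isKernelOn_extension {G : Digraph V} (hG : HasLocalFiniteHeight G) (m k : ℕ) :
    ∃ l, ∀ F F' : Finset V, F ⊆ F' → F'.card ≤ m → ∀ U : Set V,
      IsKernelOn G (clStep G F l) U →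
      ∃ U' : Set V, IsKernelOn G (clStep G F' k) U' ∧ ∀ a ∈ F, a ∈ U' ↔ a ∈ U := by
  -- A single parameter bounds both the size of `F'` and the depth of the closure. Depth `k + 1`
  -- keeps the out-neighbours of `clStep G F' k` inside `R`.
  obtain ⟨h, hh⟩ := hG (max m (k + 1))
  set M := max m (k + 1)
  refine ⟨M + h, fun F F' hFF hF' U hU => ?_⟩
  obtain ⟨hfin, hht⟩ := hh F' (hF'.trans (le_max_left _ _))
  set R := clStep G (F' : Set V) M with hR
  have hno := fun a b => not_edgePow_of_height_le hfin hht (Nat.lt_succ_self h) a b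
  have hwf : WellFounded fun x y : R => (induced G R).Adj y x :=
    ⟨fun a => acc_of_not_edgePow fun b => hno a b⟩
  have hFR : clStep G (F : Set V) M ⊆ R := clStep_mono (by exact_mod_cast hFF) M
  -- `C` is closed under out-neighbours in `R`, so the prescribed values never clash with the
  -- recursive ones. Walks in `R` have at most `h` edges, whence the depth `M + h`.
  let C : Set R := {d | ∃ c : R, (c : V) ∈ clStep G (F : Set V) M ∧
    ∃ n, edgePow (induced G R) n c d}
  have hCU : ∀ d ∈ C, (d : V) ∈ clStep G (F : Set V) (M + h) := by
    rintro d ⟨c, hc, n, hn⟩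
    have hnh : n ≤ h := by
      by_contra hlt
      obtain ⟨e, he⟩ := exists_edgePow_of_le (m := h + 1) (by omega) hn
      exact hno _ _ he
    exact clStep_monotone G _ (by omega) (mem_clStep_add_of_edgePow hc (edgePow_induced hn))
  obtain ⟨K, hKC, hK⟩ := exists_kernel_extending hwf C {d | (d : V) ∈ U}
  refine ⟨Subtype.val '' K, fun a ha => ?_, fun a ha => ?_⟩
  · have hkM : k + 1 ≤ M := le_max_right _ _
    have haR : a ∈ R := clStep_monotone G _ (by omega) ha
    have hsucc : ∀ b, G.Adj a b → b ∈ R := fun b hb =>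
      clStep_monotone G _ hkM (clStep_succ_of_adj ha hb)
    have hmem : ∀ b (hb : b ∈ R), b ∈ Subtype.val '' K ↔ (⟨b, hb⟩ : R) ∈ K := by
      intro b hb; simp [hb]
    rw [hmem a haR]
    by_cases haC : (⟨a, haR⟩ : R) ∈ C
    · rw [hKC _ haC, Set.mem_ofPred_eq, hU a (hCU _ haC)]
      refine forall₂_congr fun b hb => not_congr ?_
      rw [hmem b (hsucc b hb), hKC]
      · rfl
      · obtain ⟨c, hc, n, hn⟩ := haC
        exact ⟨c, hc, n + 1, edgePow_succ_right hn hb⟩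
    · rw [hK _ haC]
      constructor
      · intro H b hb
        rw [hmem b (hsucc b hb)]
        exact H _ hb
      · rintro H ⟨b, hbR⟩ hb
        have := H b hb
        rwa [hmem b hbR] at this
  · have haM : a ∈ clStep G (F : Set V) M := subset_clStep G _ M ha
    have haC : (⟨a, hFR haM⟩ : R) ∈ C := ⟨⟨a, hFR haM⟩, haM, 0, rfl⟩
    have haU : _ ↔ a ∈ U := hKC _ haC
    rw [← haU]
    simp [hFR haM]

end Combinatorics

/-! ### The kernel game -/

section Game

variable {M : Type u}

/-- In the kernel game a position is a set `I` of vertices declared to lie in the kernel.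
In each round the opponent names a vertex `x` and the player adds to `I` either `x` or an
out-neighbour of `x`. `Lost r n I` says that from the position `I` the opponent can within `n`
rounds force an edge between two vertices of the position. -/
def Lost (r : M → M → Prop) : ℕ → Set M → Prop
  | 0, I => ∃ a ∈ I, ∃ b ∈ I, r a b
  | n + 1, I => ∃ x, ∀ y, (y = x ∨ r x y) → Lost r n (insert y I)

theorem Lost.mono {r : M → M → Prop} :
    ∀ {n : ℕ} {I J : Set M}, I ⊆ J → Lost r n I → Lost r n J
  | 0, _, _, hIJ, ⟨a, ha, b, hb, h⟩ => ⟨a, hIJ ha, b, hIJ hb, h⟩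
  | _ + 1, _, _, hIJ, ⟨x, hx⟩ => ⟨x, fun y hy => (hx y hy).mono (Set.insert_subset_insert hIJ)⟩

theorem Lost.succ [Nonempty M] {r : M → M → Prop} {n : ℕ} {I : Set M} (h : Lost r n I) :
    Lost r (n + 1) I :=
  ⟨Classical.arbitrary M, fun y _ => h.mono (Set.subset_insert y I)⟩

theorem Lost.of_le [Nonempty M] {r : M → M → Prop} {m n : ℕ} {I : Set M} (hmn : m ≤ n)
    (h : Lost r m I) : Lost r n I := by
  induction hmn with
  | refl => exact h
  | step _ ih => exact ih.succ

/-- The player follows a partial kernel containing the position. After a challenge `x` it is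
extended to a neighbourhood of `I ∪ {x}`, and there either `x` or an out-neighbour of `x` belongs to
it. The radius `k` must be uniform in `I`, since each round enlarges the position. -/
theorem exists_not_lost_of_isKernelOn {G : Digraph M} (hG : HasLocalFiniteHeight G) (n : ℕ) :
    ∀ m : ℕ, ∃ k, ∀ I : Finset M, I.card ≤ m → ∀ U : Set M, IsKernelOn G (clStep G I k) U →
      (I : Set M) ⊆ U → ¬ Lost G.Adj n I := by
  classical
  induction n with
  | zero =>
    refine fun m => ⟨0, fun I _ U hU hI => ?_⟩
    rintro ⟨a, ha, b, hb, hab⟩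
    exact (hU a ha).1 (hI ha) b hab (hI hb)
  | succ n ih =>
    intro m
    obtain ⟨k, hk⟩ := ih (m + 1)
    obtain ⟨l, hl⟩ := exists_isKernelOn_extension hG (m + 1) (k + 1)
    refine ⟨l, fun I hIm U hU hI => ?_⟩
    rintro ⟨x, hx⟩
    obtain ⟨U', hU', hag⟩ := hl I (insert x I) (Finset.subset_insert x I)
      ((Finset.card_insert_le x I).trans (by omega)) U hU
    have key : ∃ y ∈ U', y = x ∨ G.Adj x y := by
      by_cases hxU : x ∈ U'
      · exact ⟨x, hxU, Or.inl rfl⟩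
      · rw [hU' x (subset_clStep G _ _ (by simp))] at hxU
        push Not at hxU
        obtain ⟨b, hb, hbU⟩ := hxU
        exact ⟨b, hbU, Or.inr hb⟩
    obtain ⟨y, hyU, hy⟩ := key
    -- The answer `y` may be an out-neighbour of `x`, so the new position lies only in the 1-step
    -- closure of `insert x I`. This costs the extra step in `k + 1`.
    refine hk (insert y I) ((Finset.card_insert_le y I).trans (by omega)) U'
      (hU'.mono (clStep_subset_clStep_succ ?_ k)) ?_ (by simpa using hx y hy)
    · intro a ha
      rw [Finset.coe_insert, Set.mem_insert_iff] at ha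
      rcases ha with rfl | ha
      · rcases hy with rfl | hy
        · exact Or.inl (by simp)
        · exact Or.inr ⟨x, by simp [clStep], hy⟩
      · exact Or.inl (by simpa using Or.inr ha)
    · intro a ha
      rw [Finset.coe_insert, Set.mem_insert_iff] at ha
      rcases ha with rfl | ha
      · exact hyU
      · exact (hag a ha).2 (hI ha)

/-- The closure of the empty set is empty, so the required partial kernel is vacuous. -/
theorem not_lost_empty {G : Digraph M} (hG : HasLocalFiniteHeight G) (n : ℕ) :
    ¬ Lost G.Adj n ∅ := by
  obtain ⟨k, hk⟩ := exists_not_lost_of_isKernelOn hG n 0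
  simpa using hk ∅ (by simp) ∅ (by simp [IsKernelOn, clStep_empty]) (by simp)

/-- If the vertices of a countable digraph can be enumerated by the opponent and the player never
loses, then the vertices chosen by the player form a kernel. -/
theorem exists_isKernel_of_game [Countable M] (G : Digraph M) (P : List M → Prop) (h0 : P [])
    (hstep : ∀ I x, P I → ∃ y, (y = x ∨ G.Adj x y) ∧ P (y :: I))
    (hindep : ∀ I, P I → ∀ a ∈ I, ∀ b ∈ I, ¬ G.Adj a b) : ∃ K : Set M, IsKernel G K := by
  cases isEmpty_or_nonempty M with
  | inl h => exact ⟨∅, fun a => h.elim a⟩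
  | inr h =>
    obtain ⟨x, hx⟩ := exists_surjective_nat M
    choose! σ hσ using hstep
    let I : ℕ → List M := fun n => Nat.rec [] (fun n l => σ l (x n) :: l) n
    have hsucc : ∀ n, I (n + 1) = σ (I n) (x n) :: I n := fun _ => rfl
    have hP : ∀ n, P (I n) := by
      intro n
      induction n with
      | zero => exact h0
      | succ n ih => rw [hsucc]; exact (hσ _ _ ih).2
    have hmono : Monotone fun n => {a | a ∈ I n} :=
      monotone_nat_of_le_succ fun n a ha => by
        change a ∈ I (n + 1)
        rw [hsucc]; exact List.mem_cons_of_mem _ ha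
    refine ⟨{a | ∃ n, a ∈ I n}, fun a => ⟨?_, fun H => ?_⟩⟩
    · rintro ⟨n, hn⟩ b hab ⟨m, hm⟩
      exact hindep _ (hP (max n m)) a (hmono (le_max_left n m) hn) b
        (hmono (le_max_right n m) hm) hab
    · obtain ⟨n, rfl⟩ := hx a
      have hmem : σ (I n) (x n) ∈ I (n + 1) := by rw [hsucc]; exact List.mem_cons_self
      rcases (hσ (I n) (x n) (hP n)).1 with he | he
      · exact ⟨n + 1, he ▸ hmem⟩
      · exact (H _ he ⟨n + 1, hmem⟩).elim

end Game

end DigraphKernel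

namespace DigraphKernel

/-! ### First-order formulas for the game -/

section Formulas

open FirstOrder.Language

variable {k : ℕ}

/-- The formula `t₁ E t₂`. -/
def adjFormula {d : ℕ} (t₁ t₂ : Language.graph.Term (Fin k ⊕ Fin d)) :
    Language.graph.BoundedFormula (Fin k) d :=
  .rel Language.adj ![t₁, t₂]

/-- The formula `t₂ = t₁ ∨ t₁ E t₂`: `t₂` is an answer of the player to the challenge `t₁`. -/
def moveFormula {d : ℕ} (t₁ t₂ : Language.graph.Term (Fin k ⊕ Fin d)) :
    Language.graph.BoundedFormula (Fin k) d :=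
  ((BoundedFormula.equal t₂ t₁).imp .falsum).imp (adjFormula t₁ t₂)

/-- The disjunction of the formulas `p.1 E p.2` for the pairs `p` in a list. -/
def anyAdjFormula {d : ℕ} :
    List (Language.graph.Term (Fin k ⊕ Fin d) × Language.graph.Term (Fin k ⊕ Fin d)) →
      Language.graph.BoundedFormula (Fin k) d
  | [] => .falsum
  | p :: l => ((adjFormula p.1 p.2).imp .falsum).imp (anyAdjFormula l)

/-- The terms that denote the position after `e` rounds of the game, begun at the position given
by the free variables in `ps`. The bound variables `2 * i` and `2 * i + 1` are the moves of
the opponent and of the player. -/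
def positionTerms (ps : List (Fin k)) (e : ℕ) :
    List (Language.graph.Term (Fin k ⊕ Fin (2 * e))) :=
  ps.map (fun i => .var (Sum.inl i)) ++
    (List.finRange e).map fun i => .var (Sum.inr ⟨2 * (i : ℕ) + 1, by omega⟩)

/-- The formula saying that the opponent can win within `n` rounds, when `e` rounds have been
played beginning at the position given by the free variables in `ps`. -/
def lostFormula (ps : List (Fin k)) :
    (n e : ℕ) → Language.graph.BoundedFormula (Fin k) (2 * e)
  | 0, e => anyAdjFormula (positionTerms ps e ×ˢ positionTerms ps e)
  | n + 1, e =>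
    -- The quantifiers `∃ x ∀ y` are spelled with the primitive constructors, so that the Gödel
    -- number can be read off directly.
    .imp (.all (.imp (.all (.imp
      (moveFormula (d := 2 * (e + 1)) (.var (Sum.inr ⟨2 * e, by omega⟩))
        (.var (Sum.inr ⟨2 * e + 1, by omega⟩)))
      (lostFormula ps n (e + 1)))) .falsum)) .falsum

/-- The formula saying that the variable `0` answers the challenge given by the variable `1`, and
that afterwards the player can survive `n` rounds from the position given by all variables
but `1`. -/
def answerFormula (m n : ℕ) : Language.graph.Formula (Fin (m + 1 + 1)) :=
  (((moveFormula (d := 0) (.var (Sum.inl 1)) (.var (Sum.inl 0))).imp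
    (lostFormula (0 :: (List.finRange m).map fun i => i.succ.succ) n 0)).imp .falsum :
      Language.graph.BoundedFormula (Fin (m + 1 + 1)) 0)

section Realize

variable {M : Type u} [Language.graph.Structure M]

variable (M) in
/-- The edge relation of a structure in the language of digraphs. -/
def edge (x y : M) : Prop := Structure.RelMap Language.adj ![x, y]

theorem realize_adjFormula {d : ℕ} (t₁ t₂ : Language.graph.Term (Fin k ⊕ Fin d))
    (v : Fin k → M) (xs : Fin d → M) :
    (adjFormula t₁ t₂).Realize v xs ↔
      edge M (t₁.realize (Sum.elim v xs)) (t₂.realize (Sum.elim v xs)) := by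
  simp only [adjFormula, BoundedFormula.Realize, edge]
  rw [iff_iff_eq]
  congr 1
  funext i
  fin_cases i <;> rfl

theorem realize_moveFormula {d : ℕ} (t₁ t₂ : Language.graph.Term (Fin k ⊕ Fin d))
    (v : Fin k → M) (xs : Fin d → M) :
    (moveFormula t₁ t₂).Realize v xs ↔
      (t₂.realize (Sum.elim v xs) = t₁.realize (Sum.elim v xs) ∨
        edge M (t₁.realize (Sum.elim v xs)) (t₂.realize (Sum.elim v xs))) := by
  rw [← realize_adjFormula]
  simp only [moveFormula, BoundedFormula.Realize]
  tauto

theorem realize_anyAdjFormula {d : ℕ}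
    (l : List (Language.graph.Term (Fin k ⊕ Fin d) × Language.graph.Term (Fin k ⊕ Fin d)))
    (v : Fin k → M) (xs : Fin d → M) :
    (anyAdjFormula l).Realize v xs ↔
      ∃ p ∈ l, edge M (p.1.realize (Sum.elim v xs)) (p.2.realize (Sum.elim v xs)) := by
  induction l with
  | nil => simp [anyAdjFormula, BoundedFormula.Realize]
  | cons p l ih =>
    rw [List.exists_mem_cons_iff, ← ih, ← realize_adjFormula]
    simp only [anyAdjFormula, BoundedFormula.Realize]
    tauto

/-- The position after `e` rounds. -/
def position (ps : List (Fin k)) (e : ℕ) (v : Fin k → M) (xs : Fin (2 * e) → M) : Set M :=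
  {a | ∃ t ∈ positionTerms ps e, t.realize (Sum.elim v xs) = a}

theorem mem_position {ps : List (Fin k)} {e : ℕ} {v : Fin k → M} {xs : Fin (2 * e) → M} {a : M} :
    a ∈ position ps e v xs ↔
      (∃ i ∈ ps, v i = a) ∨ ∃ i : Fin e, xs ⟨2 * (i : ℕ) + 1, by omega⟩ = a := by
  simp only [position, positionTerms, Set.mem_ofPred_eq, List.mem_append, List.mem_map,
    List.mem_finRange, true_and, or_and_right, exists_or]
  refine or_congr ⟨?_, ?_⟩ ⟨?_, ?_⟩
  · rintro ⟨_, ⟨i, hi, rfl⟩, h⟩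
    exact ⟨i, hi, h⟩
  · rintro ⟨i, hi, h⟩
    exact ⟨_, ⟨i, hi, rfl⟩, h⟩
  · rintro ⟨_, ⟨i, rfl⟩, h⟩
    exact ⟨i, h⟩
  · rintro ⟨i, h⟩
    exact ⟨_, ⟨i, rfl⟩, h⟩

theorem position_succ (ps : List (Fin k)) (e : ℕ) (v : Fin k → M) (xs : Fin (2 * e) → M)
    (x y : M) :
    position ps (e + 1) v (Fin.snoc (α := fun _ => M) (Fin.snoc (α := fun _ => M) xs x) y) =
      insert y (position ps e v xs) := by
  ext a
  have hlast : (Fin.snoc (α := fun _ => M) (Fin.snoc (α := fun _ => M) xs x) y :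
      Fin (2 * (e + 1)) → M) ⟨2 * e + 1, (by omega : 2 * e + 1 < 2 * (e + 1))⟩ = y :=
    Fin.snoc_last (α := fun _ => M) y (Fin.snoc (α := fun _ => M) xs x)
  have hprev : ∀ i : Fin e, (Fin.snoc (α := fun _ => M) (Fin.snoc (α := fun _ => M) xs x) y :
      Fin (2 * (e + 1)) → M)
        ⟨2 * (i : ℕ) + 1, (by omega : 2 * (i : ℕ) + 1 < 2 * (e + 1))⟩ =
        xs ⟨2 * (i : ℕ) + 1, by omega⟩ :=
    fun i => (Fin.snoc_castSucc (α := fun _ => M) y (Fin.snoc (α := fun _ => M) xs x)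
      ⟨2 * (i : ℕ) + 1, by omega⟩).trans
        (Fin.snoc_castSucc (α := fun _ => M) x xs ⟨2 * (i : ℕ) + 1, by omega⟩)
  rw [Set.mem_insert_iff, mem_position, mem_position, Fin.exists_fin_succ']
  simp only [Fin.val_castSucc, Fin.val_last, hlast, hprev]
  rw [← or_assoc, or_comm, eq_comm]

theorem realize_lostFormula (ps : List (Fin k)) :
    ∀ (n e : ℕ) (v : Fin k → M) (xs : Fin (2 * e) → M),
      (lostFormula ps n e).Realize v xs ↔ Lost (edge M) n (position ps e v xs)
  | 0, e, v, xs => by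
    rw [lostFormula, realize_anyAdjFormula]
    constructor
    · rintro ⟨p, hp, h⟩
      rw [List.mem_product] at hp
      exact ⟨_, ⟨_, hp.1, rfl⟩, _, ⟨_, hp.2, rfl⟩, h⟩
    · rintro ⟨_, ⟨t₁, h₁, rfl⟩, _, ⟨t₂, h₂, rfl⟩, h⟩
      exact ⟨(t₁, t₂), List.mem_product.2 ⟨h₁, h₂⟩, h⟩
  | n + 1, e, v, xs => by
    have key : ∀ x y : M, (lostFormula ps n (e + 1)).Realize v
        (Fin.snoc (α := fun _ => M) (Fin.snoc (α := fun _ => M) xs x) y) ↔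
          Lost (edge M) n (insert y (position ps e v xs)) := fun x y => by
      rw [realize_lostFormula ps n (e + 1), position_succ]
    have hy : ∀ x y : M, (Fin.snoc (α := fun _ => M) (Fin.snoc (α := fun _ => M) xs x) y :
        Fin (2 * (e + 1)) → M) ⟨2 * e + 1, (by omega : 2 * e + 1 < 2 * (e + 1))⟩ = y := fun x y =>
      Fin.snoc_last (α := fun _ => M) y (Fin.snoc (α := fun _ => M) xs x)
    have hx : ∀ x y : M, (Fin.snoc (α := fun _ => M) (Fin.snoc (α := fun _ => M) xs x) y :
        Fin (2 * (e + 1)) → M) ⟨2 * e, (by omega : 2 * e < 2 * (e + 1))⟩ = x := fun x y =>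
      (Fin.snoc_castSucc (α := fun _ => M) y (Fin.snoc (α := fun _ => M) xs x)
        (Fin.last (2 * e))).trans (Fin.snoc_last (α := fun _ => M) x xs)
    have hm : ∀ x y : M, (moveFormula (k := k) (d := 2 * (e + 1))
        (.var (Sum.inr ⟨2 * e, (by omega : 2 * e < 2 * (e + 1))⟩))
          (.var (Sum.inr ⟨2 * e + 1, (by omega : 2 * e + 1 < 2 * (e + 1))⟩))).Realize v
        (Fin.snoc (α := fun _ => M) (Fin.snoc (α := fun _ => M) xs x) y) ↔
          (y = x ∨ edge M x y) := fun x y => by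
      rw [realize_moveFormula, Term.realize_var, Term.realize_var, Sum.elim_inr, Sum.elim_inr,
        hx, hy]
    have hex : (lostFormula ps (n + 1) e).Realize v xs ↔
        ¬ ∀ x : M, ¬ ∀ y : M, (moveFormula (k := k) (d := 2 * (e + 1))
          (.var (Sum.inr ⟨2 * e, (by omega : 2 * e < 2 * (e + 1))⟩))
          (.var (Sum.inr ⟨2 * e + 1, (by omega : 2 * e + 1 < 2 * (e + 1))⟩))).Realize v
          (Fin.snoc (α := fun _ => M) (Fin.snoc (α := fun _ => M) xs x) y) →
          (lostFormula ps n (e + 1)).Realize v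
            (Fin.snoc (α := fun _ => M) (Fin.snoc (α := fun _ => M) xs x) y) := Iff.rfl
    rw [hex, not_forall]
    simp only [not_not, hm, key, Lost]

theorem realize_answerFormula (n : ℕ) (y x : M) (I : List M) :
    (answerFormula I.length n).Realize (Fin.cons y (Fin.cons x I.get : Fin (I.length + 1) → M) :
        Fin (I.length + 1 + 1) → M) ↔
      (y = x ∨ edge M x y) ∧ ¬ Lost (edge M) n {a | a ∈ y :: I} := by
  have h : position (M := M) (0 :: (List.finRange I.length).map fun i => i.succ.succ) 0
      (Fin.cons y (Fin.cons x I.get : Fin (I.length + 1) → M) : Fin (I.length + 1 + 1) → M)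
      (default : Fin 0 → M) = {a | a ∈ y :: I} := by
    ext a
    rw [mem_position]
    simp only [List.mem_cons, List.mem_map, List.mem_finRange, true_and, Set.mem_ofPred_eq,
      IsEmpty.exists_iff, or_false, or_and_right, exists_or, exists_eq_left, Fin.cons_zero]
    refine or_congr eq_comm ⟨?_, fun h => ?_⟩
    · rintro ⟨_, ⟨i, rfl⟩, rfl⟩
      exact List.get_mem I i
    · obtain ⟨i, rfl⟩ := List.mem_iff_get.1 h
      exact ⟨_, ⟨i, rfl⟩, rfl⟩
  rw [← h, ← realize_lostFormula]
  have hm := realize_moveFormula (d := 0) (k := I.length + 1 + 1) (.var (Sum.inl 1))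
    (.var (Sum.inl 0)) (Fin.cons y (Fin.cons x I.get : Fin (I.length + 1) → M)) default
  change _ ↔ (y = x ∨ edge M x y) at hm
  rw [← hm, ← Classical.not_imp]
  exact Iff.rfl

end Realize

end Formulas

end DigraphKernel

namespace DigraphKernel

/-! ### Recursiveness of the types of good answers -/

section Codes

open FirstOrder.Language

variable {k : ℕ}

/-- The code of an implication. -/
def impCode (a b : ℕ) : ℕ := 4 * Nat.pair a b + 3

/-- The code of `adjFormula`. -/
def adjCode (a b : ℕ) : ℕ := 4 * Nat.pair a b + 2

/-- The code of `moveFormula`. -/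
def moveCode (a b : ℕ) : ℕ := impCode (impCode (4 * Nat.pair b a + 1) 0) (adjCode a b)

/-- The code of `anyAdjFormula`. -/
def anyAdjCode (l : List (ℕ × ℕ)) : ℕ :=
  l.foldr (fun p c => impCode (impCode (adjCode p.1 p.2) 0) c) 0

/-- The codes of `positionTerms`. -/
def positionCodes (ps : List ℕ) (e : ℕ) : List ℕ :=
  ps ++ (List.range e).map fun i => 2 * (2 * i + 1) + 1

/-- The code of `lostFormula ps (n + 1) e`, where `c` is the code of `lostFormula ps n (e + 1)`. -/
def lostCodeStep (e c : ℕ) : ℕ :=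
  impCode (4 * impCode (4 * impCode (moveCode (2 * (2 * e) + 1) (2 * (2 * e + 1) + 1)) c + 4) 0 + 4)
    0

/-- The code of `lostFormula ps n (N - n)` for `n ≤ N`. -/
def lostCode (ps : List ℕ) (N n : ℕ) : ℕ :=
  Nat.rec (motive := fun _ => ℕ)
    (anyAdjCode ((positionCodes ps N).flatMap fun a => (positionCodes ps N).map (Prod.mk a)))
    (fun n c => lostCodeStep (N - (n + 1)) c) n

theorem formulaCode_imp {d : ℕ} (φ ψ : Language.graph.BoundedFormula (Fin k) d) :
    formulaCode (.imp φ ψ) = impCode (formulaCode φ) (formulaCode ψ) := rfl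

theorem formulaCode_all {d : ℕ} (φ : Language.graph.BoundedFormula (Fin k) (d + 1)) :
    formulaCode (.all φ) = 4 * formulaCode φ + 4 := rfl

theorem formulaCode_falsum {d : ℕ} :
    formulaCode (.falsum : Language.graph.BoundedFormula (Fin k) d) = 0 := rfl

theorem formulaCode_adjFormula {d : ℕ} (t₁ t₂ : Language.graph.Term (Fin k ⊕ Fin d)) :
    formulaCode (adjFormula t₁ t₂) = adjCode (termCode t₁) (termCode t₂) := rfl

theorem formulaCode_anyAdjFormula {d : ℕ}
    (l : List (Language.graph.Term (Fin k ⊕ Fin d) × Language.graph.Term (Fin k ⊕ Fin d))) :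
    formulaCode (anyAdjFormula l) = anyAdjCode (l.map (Prod.map termCode termCode)) := by
  induction l with
  | nil => rfl
  | cons p l ih =>
    rw [anyAdjFormula, formulaCode_imp, formulaCode_imp, formulaCode_adjFormula,
      formulaCode_falsum, ih]
    rfl

theorem map_termCode_positionTerms (ps : List (Fin k)) (e : ℕ) :
    (positionTerms ps e).map termCode = positionCodes (ps.map fun i : Fin k => 2 * (i : ℕ)) e := by
  rw [positionTerms, positionCodes, List.map_append, List.map_map, List.map_map,
    ← List.map_coe_finRange_eq_range, List.map_map]
  rfl

/-- The recursion lowers `n` and raises `e`, leaving `n + e` fixed. With this sum as the parameter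
`N`, it becomes a primitive recursion in `n` alone. -/
theorem formulaCode_lostFormula (ps : List (Fin k)) (N : ℕ) :
    ∀ n e : ℕ, n + e = N →
      formulaCode (lostFormula ps n e) = lostCode (ps.map fun i : Fin k => 2 * (i : ℕ)) N n
  | 0, e, h => by
    obtain rfl : e = N := by omega
    rw [lostFormula, formulaCode_anyAdjFormula, lostCode, ← map_termCode_positionTerms]
    congr 1
    simp [SProd.sprod, List.product, List.map_flatMap, List.flatMap_map, Function.comp_def]
  | n + 1, e, h => by
    obtain rfl : e = N - (n + 1) := by omega
    have ih := formulaCode_lostFormula ps N n (N - (n + 1) + 1) (by omega)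
    rw [lostFormula, formulaCode_imp, formulaCode_all, formulaCode_imp, formulaCode_all,
      formulaCode_imp, ih]
    rfl

theorem formulaCode_answerFormula (m n : ℕ) :
    formulaCode (answerFormula m n) =
      impCode (impCode (moveCode 2 0)
        (lostCode ((0 :: (List.finRange m).map fun i => i.succ.succ : List (Fin (m + 1 + 1))).map
          fun i : Fin (m + 1 + 1) => 2 * (i : ℕ)) n n)) 0 := by
  rw [← formulaCode_lostFormula _ n n 0 rfl]
  rfl

/-- This bounds the search when deciding whether a number is the code of some `answerFormula m n`.
-/
theorem le_lostCode (ps : List ℕ) (N n : ℕ) : n ≤ lostCode ps N n := by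
  induction n with
  | zero => exact Nat.zero_le _
  | succ n ih =>
    change n + 1 ≤ lostCodeStep (N - (n + 1)) (lostCode ps N n)
    refine (Nat.succ_le_succ ih).trans ?_
    rw [lostCodeStep]
    generalize moveCode _ _ = c
    have h₁ := Nat.right_le_pair c (lostCode ps N n)
    have h₂ := Nat.left_le_pair (4 * impCode c (lostCode ps N n) + 4) 0
    have h₃ := Nat.left_le_pair (4 * impCode (4 * impCode c (lostCode ps N n) + 4) 0 + 4) 0
    simp only [impCode] at *
    omega

theorem le_formulaCode_answerFormula (m n : ℕ) : n ≤ formulaCode (answerFormula m n) := by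
  rw [formulaCode_answerFormula]
  generalize List.map _ _ = ps
  have h₁ := Nat.right_le_pair (moveCode 2 0) (lostCode ps n n)
  have h₂ := Nat.left_le_pair (impCode (moveCode 2 0) (lostCode ps n n)) 0
  have h₃ := le_lostCode ps n n
  simp only [impCode] at *
  omega

open Primrec in
theorem primrec_impCode : Primrec₂ impCode :=
  nat_add.comp₂ (nat_mul.comp₂ (Primrec₂.const 4) Primrec₂.natPair) (Primrec₂.const 3)

open Primrec in
theorem primrec_adjCode : Primrec₂ adjCode :=
  nat_add.comp₂ (nat_mul.comp₂ (Primrec₂.const 4) Primrec₂.natPair) (Primrec₂.const 2)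

open Primrec in
theorem primrec_moveCode : Primrec₂ moveCode := by
  have h : Primrec₂ fun a b : ℕ => 4 * Nat.pair b a + 1 :=
    nat_add.comp₂ (nat_mul.comp₂ (Primrec₂.const 4)
      (Primrec₂.natPair.comp₂ Primrec₂.right Primrec₂.left)) (Primrec₂.const 1)
  have h' : Primrec₂ fun a b : ℕ => impCode (4 * Nat.pair b a + 1) 0 :=
    primrec_impCode.comp₂ h (Primrec₂.const 0)
  exact primrec_impCode.comp₂ h' primrec_adjCode

open Primrec in
theorem primrec_anyAdjCode : Primrec anyAdjCode := by
  have h : Primrec₂ fun (_ : List (ℕ × ℕ)) (q : (ℕ × ℕ) × ℕ) =>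
      impCode (impCode (adjCode q.1.1 q.1.2) 0) q.2 :=
    primrec_impCode.comp₂
      (primrec_impCode.comp₂
        (primrec_adjCode.comp₂ (fst.comp (fst.comp snd)) (snd.comp (fst.comp snd)))
        (Primrec₂.const 0))
      (snd.comp snd)
  exact list_foldr .id (const 0) h

open Primrec in
theorem primrec_positionCodes (ps : List ℕ) : Primrec (positionCodes ps) := by
  refine list_append.comp (const ps) (list_map list_range ?_)
  have h : Primrec fun i : ℕ => 2 * (2 * i + 1) + 1 :=
    succ.comp (nat_mul.comp (const 2) (succ.comp (nat_mul.comp (const 2) .id)))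
  exact h.comp snd

open Primrec in
theorem primrec_lostCodeStep : Primrec₂ lostCodeStep := by
  have h₁ : Primrec fun e : ℕ => 2 * (2 * e) + 1 :=
    succ.comp (nat_mul.comp (const 2) (nat_mul.comp (const 2) .id))
  have h₂ : Primrec fun i : ℕ => 2 * (2 * i + 1) + 1 :=
    succ.comp (nat_mul.comp (const 2) (succ.comp (nat_mul.comp (const 2) .id)))
  have h₃ : Primrec fun a : ℕ => 4 * a + 4 :=
    nat_add.comp (nat_mul.comp (const 4) .id) (const 4)
  have h₄ : Primrec fun a : ℕ => impCode a 0 := primrec_impCode.comp .id (const 0)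
  exact h₄.comp₂ (h₃.comp₂ (h₄.comp₂ (h₃.comp₂ (primrec_impCode.comp₂
    ((primrec_moveCode.comp h₁ h₂).comp fst) Primrec₂.right))))

open Primrec in
theorem primrec_lostCode (ps : List ℕ) : Primrec₂ (lostCode ps) := by
  refine nat_rec (g := fun N q => lostCodeStep (N - (q.1 + 1)) q.2) ?_ ?_
  · refine primrec_anyAdjCode.comp (list_flatMap (primrec_positionCodes ps) ?_)
    exact list_map ((primrec_positionCodes ps).comp fst)
      (Primrec₂.pair.comp₂ (snd.comp fst) Primrec₂.right)
  · exact primrec_lostCodeStep.comp₂ (nat_sub.comp₂ Primrec₂.left (succ.comp (fst.comp snd)))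
      (snd.comp snd)

open Primrec in
theorem primrec_formulaCode_answerFormula (m : ℕ) :
    Primrec fun n => formulaCode (answerFormula m n) := by
  simp only [formulaCode_answerFormula]
  exact primrec_impCode.comp (primrec_impCode.comp (const _)
    ((primrec_lostCode _).comp .id .id)) (const 0)

theorem recursiveSet_range_answerFormula (m : ℕ) : RecursiveSet (Set.range (answerFormula m)) := by
  have hrel : PrimrecRel fun n c : ℕ => formulaCode (answerFormula m n) = c :=
    Primrec.eq.comp₂ ((primrec_formulaCode_answerFormula m).comp Primrec.fst) Primrec₂.right
  have hpred : PrimrecPred fun c : ℕ => ∃ n < c + 1, formulaCode (answerFormula m n) = c :=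
    hrel.exists_lt.comp Primrec.succ .id
  refine (hpred.of_eq fun c => ?_).computablePred
  rw [Set.exists_range_iff]
  constructor
  · rintro ⟨n, -, h⟩
    exact ⟨n, h⟩
  · rintro ⟨n, h⟩
    exact ⟨n, Nat.lt_succ_of_le (h ▸ le_formulaCode_answerFormula m n), h⟩

end Codes

/-! ### Good answers, and the recursively saturated case -/

section AnswerTypes

variable {M : Type u} [Language.graph.Structure M]

variable (M) in
/-- If the player can survive any number of rounds from a position, then every challenge has an
answer after which this remains true. -/
def HasGoodAnswers : Prop :=
  ∀ (I : List M) (x : M), (∀ n, ¬ Lost (edge M) n {a | a ∈ I}) →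
    ∃ y, (y = x ∨ edge M x y) ∧ ∀ n, ¬ Lost (edge M) n {a | a ∈ y :: I}

/-- It suffices that the types of good answers are realized if they are finitely satisfiable. -/
theorem hasGoodAnswers_of_realize
    (h : ∀ (m : ℕ) (a : Fin (m + 1) → M),
      (∀ n, ∃ y : M, ∀ i ≤ n,
        (answerFormula m i).Realize (Fin.cons y a : Fin (m + 1 + 1) → M)) →
      ∃ y : M, ∀ i, (answerFormula m i).Realize (Fin.cons y a : Fin (m + 1 + 1) → M)) :
    HasGoodAnswers M := by
  intro I x hI
  have : Nonempty M := ⟨x⟩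
  obtain ⟨y, hy⟩ := h I.length (Fin.cons x I.get) fun n => by
    -- Surviving `n + 1` rounds yields an answer after which `n` rounds can be survived, hence also
    -- every `i ≤ n`. A priori this answer depends on `n`.
    have hn := hI (n + 1)
    simp only [Lost, not_exists, not_forall] at hn
    obtain ⟨y, hxy, hy⟩ := hn x
    have he : {a | a ∈ y :: I} = insert y {a | a ∈ I} := by ext; simp
    refine ⟨y, fun i hi => (realize_answerFormula i y x I).2 ⟨hxy, fun hl => hy ?_⟩⟩
    rw [he] at hl
    exact hl.of_le hi
  simp only [realize_answerFormula] at hy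
  exact ⟨y, (hy 0).1, fun n => (hy n).2⟩

end AnswerTypes

theorem exists_isKernel_of_recursivelySaturated {V : Type u} [Countable V] {G : Digraph V}
    (hG : HasLocalFiniteHeight G) (hs : RecursivelySaturated G) : ∃ K : Set V, IsKernel G K := by
  let := toStructure G
  have hgood : HasGoodAnswers V := hasGoodAnswers_of_realize fun m a h => by
    obtain ⟨y, hy⟩ := hs (m + 1) a _ (recursiveSet_range_answerFormula m) fun s hsub => by
      have hsub' : ∀ φ ∈ s, ∃ i, answerFormula m i = φ := fun φ hφ => hsub hφ
      choose! f hf using hsub'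
      -- `f` picks an index for each formula of `s`; all these indices lie below the supremum.
      obtain ⟨y, hy⟩ := h (s.sup f)
      exact ⟨y, fun φ hφ => hf φ hφ ▸ hy (f φ) (Finset.le_sup hφ)⟩
    exact ⟨y, fun i => hy _ ⟨i, rfl⟩⟩
  refine exists_isKernel_of_game G (fun I => ∀ n, ¬ Lost G.Adj n {a | a ∈ I})
    (fun n => ?_) hgood fun I hI a ha b hb hab => hI 0 ⟨a, ha, b, hb, hab⟩
  simpa using not_lost_empty hG n

end DigraphKernel

namespace DigraphKernel

open FirstOrder.Language Filter

/-! ### Countable saturation of ultraproducts over `ℕ` -/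

section Ultrapower

/-- Ultraproducts over a nonprincipal ultrafilter on `ℕ` realize countable types. -/
theorem exists_realize_ultraproduct {L : FirstOrder.Language.{0, 0}} {M : ℕ → Type u}
    [∀ i, L.Structure (M i)] [∀ i, Nonempty (M i)] {k : ℕ} (φ : ℕ → L.Formula (Fin (k + 1)))
    (a : Fin k → ((hyperfilter ℕ : Ultrafilter ℕ) : Filter ℕ).Product M)
    (h : ∀ n, ∃ y, ∀ i ≤ n, (φ i).Realize
      (Fin.cons y a : Fin (k + 1) → ((hyperfilter ℕ : Ultrafilter ℕ) : Filter ℕ).Product M)) :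
    ∃ y, ∀ i, (φ i).Realize
      (Fin.cons y a : Fin (k + 1) → ((hyperfilter ℕ : Ultrafilter ℕ) : Filter ℕ).Product M) := by
  classical
  have hrep : ∀ q : ((hyperfilter ℕ : Ultrafilter ℕ) : Filter ℕ).Product M,
      ∃ g : ∀ i, M i, (g : ((hyperfilter ℕ : Ultrafilter ℕ) : Filter ℕ).Product M) = q :=
    fun q => Quotient.exists_rep q
  choose α hα using fun j => hrep (a j)
  obtain rfl : (fun j => (α j : ((hyperfilter ℕ : Ultrafilter ℕ) : Filter ℕ).Product M)) = a :=
    funext hα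
  have los : ∀ (g : ∀ i, M i) (i : ℕ), (φ i).Realize
      (Fin.cons (g : ((hyperfilter ℕ : Ultrafilter ℕ) : Filter ℕ).Product M)
        fun j => (α j : ((hyperfilter ℕ : Ultrafilter ℕ) : Filter ℕ).Product M) :
          Fin (k + 1) → _) ↔
      ∀ᶠ t in (hyperfilter ℕ : Filter ℕ), (φ i).Realize
        (Fin.cons (g t) fun j => α j t : Fin (k + 1) → M t) := by
    intro g i
    have h₁ : (fun j => ((Fin.cons g α : Fin (k + 1) → ∀ t, M t) j :
        ((hyperfilter ℕ : Ultrafilter ℕ) : Filter ℕ).Product M)) =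
        Fin.cons (g : ((hyperfilter ℕ : Ultrafilter ℕ) : Filter ℕ).Product M)
          fun j => (α j : ((hyperfilter ℕ : Ultrafilter ℕ) : Filter ℕ).Product M) :=
      funext fun j => Fin.cases rfl (fun _ => rfl) j
    have h₂ : ∀ t, (fun j => (Fin.cons g α : Fin (k + 1) → ∀ t, M t) j t) =
        Fin.cons (g t) fun j => α j t :=
      fun t => funext fun j => Fin.cases rfl (fun _ => rfl) j
    rw [← h₁]
    simp only [← h₂]
    exact Ultraproduct.realize_formula_cast (u := hyperfilter ℕ) (φ i)
      (Fin.cons g α : Fin (k + 1) → ∀ t, M t)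
  choose y hy using h
  choose η hη using fun n => hrep (y n)
  let E : ℕ → ℕ → Prop := fun n t => ∀ i ≤ n, (φ i).Realize
    (Fin.cons (η n t) fun j => α j t : Fin (k + 1) → M t)
  have hE : ∀ n, ∀ᶠ t in (hyperfilter ℕ : Filter ℕ), E n t := by
    intro n
    have : ∀ i ∈ Finset.range (n + 1), ∀ᶠ t in (hyperfilter ℕ : Filter ℕ), (φ i).Realize
        (Fin.cons (η n t) fun j => α j t : Fin (k + 1) → M t) := fun i hi => by
      rw [← los, hη]
      exact hy n i (by simpa [Nat.lt_succ_iff] using hi)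
    filter_upwards [(Filter.eventually_all_finset _).2 this] with t ht i hi
    exact ht i (by simpa [Nat.lt_succ_iff] using hi)
  -- Diagonalization: at index `t` use the best approximation `η n` with `n ≤ t` that works there.
  -- Almost every `t` is at least `i` and satisfies `E i t`, which forces `i ≤ N t`.
  let N : ℕ → ℕ := fun t => Nat.findGreatest (fun n => E n t) t
  refine ⟨((fun t => η (N t) t : ∀ t, M t) :
    ((hyperfilter ℕ : Ultrafilter ℕ) : Filter ℕ).Product M), fun i => (los _ i).2 ?_⟩
  have hge : ∀ᶠ t in (hyperfilter ℕ : Filter ℕ), i ≤ t :=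
    Nat.hyperfilter_le_atTop (eventually_ge_atTop i)
  filter_upwards [hE i, hge] with t ht hit
  exact (Nat.findGreatest_spec (P := fun n => E n t) hit ht) i (Nat.le_findGreatest hit ht)

/-- The diagonal embedding into an ultrapower, in terms of formulas. -/
theorem realize_diagonal {L : FirstOrder.Language.{0, 0}} {M : Type u} [L.Structure M] [Nonempty M]
    {ι : Type*} (w : Ultrafilter ι) {β : Type*} (φ : L.Formula β) (x : β → M) :
    φ.Realize (fun i => ((fun _ => x i : ι → M) : (w : Filter ι).Product fun _ => M)) ↔
      φ.Realize x := by
  rw [Ultraproduct.realize_formula_cast (u := w) φ fun i _ => x i]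
  exact eventually_const

end Ultrapower

/-! ### An elementary extension with a kernel -/

section Game

variable {M : Type u} [Language.graph.Structure M]

theorem realize_lostFormula_nil (n : ℕ) (v : Fin 0 → M) :
    (show Language.graph.Formula (Fin 0) from lostFormula [] n 0).Realize v ↔
      Lost (edge M) n ∅ := by
  have h := realize_lostFormula [] n 0 v (default : Fin 0 → M)
  have h0 : position (M := M) ([] : List (Fin 0)) 0 v (default : Fin 0 → M) = ∅ := by
    ext a
    simp [mem_position]
  rw [h0] at h
  exact h

variable (M) in
/-- The digraph of a structure in the language of digraphs. -/
def edgeDigraph : Digraph M where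
  Adj := edge M

/-- The language with one function symbol of each arity. -/
def strategyLanguage : FirstOrder.Language.{0, 0} where
  Functions _ := Unit
  Relations _ := Empty

/-- The interpretation of the function symbols as a strategy, with the challenge
as the first argument. -/
@[reducible]
noncomputable def strategyStructure [Nonempty M] (σ : List M → M → M) :
    strategyLanguage.Structure M where
  funMap {n} _ := match n with
    -- A constant has no argument for the challenge, so its value is a dummy.
    | 0 => fun _ => Classical.arbitrary M
    | _ + 1 => fun x => σ (List.ofFn (Fin.tail x)) (x 0)
  RelMap r := r.elim

/-- This is the downward Löwenheim–Skolem theorem. A countable `N` is treated apart because it may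
be finite and then has no substructure of cardinality `ℵ₀`. -/
theorem exists_countable_elementarySubstructure {L : FirstOrder.Language.{0, 0}}
    [Countable L.Symbols] {N : Type u} [L.Structure N] {s : Set N} (hs : s.Countable) :
    ∃ S : L.ElementarySubstructure N, s ⊆ S ∧ Countable S := by
  by_cases hN : Countable N
  · exact ⟨⊤, fun _ _ => trivial, inferInstance⟩
  · obtain ⟨S, hsS, hS⟩ := exists_elementarySubstructure_card_eq L s Cardinal.aleph0.{u} le_rfl
      (by simpa using hs.le_aleph0)
      (by
        rw [Cardinal.lift_aleph0, Cardinal.lift_le_aleph0]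
        exact Cardinal.mk_le_aleph0 (α := L.Symbols))
      (by
        have := Cardinal.mk_le_aleph0_iff.not.2 hN
        simpa using (not_le.1 this).le)
    refine ⟨S, hsS, ?_⟩
    have : Cardinal.mk S = Cardinal.aleph0 := by simpa using hS
    exact Cardinal.mk_le_aleph0_iff.1 this.le

/-- In a structure in which good answers exist, each countable set is covered by a countable
elementary substructure which has a kernel. -/
theorem exists_countable_elementaryEmbedding_isKernel [Nonempty M] (hM : HasGoodAnswers M)
    (h0 : ∀ n, ¬ Lost (edge M) n ∅) {s : Set M} (hs : s.Countable) :
    ∃ (B : Type u) (_ : Language.graph.Structure B) (f : B ↪ₑ[Language.graph] M) (K : Set B),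
      s ⊆ Set.range f ∧ IsKernel (edgeDigraph B) K := by
  unfold HasGoodAnswers at hM
  choose! σ hσ using hM
  let := strategyStructure σ
  have : Countable (Language.graph.sum strategyLanguage).Symbols := by
    have h₁ : ∀ l, Countable ((Language.graph.sum strategyLanguage).Functions l) :=
      fun _ => inferInstanceAs (Countable (Empty ⊕ Unit))
    have h₂ : ∀ l, Countable ((Language.graph.sum strategyLanguage).Relations l) :=
      fun l => inferInstanceAs (Countable (Language.graph.Relations l ⊕ Empty))
    exact inferInstanceAs (Countable ((Σ l, _) ⊕ Σ l, _))
  obtain ⟨S, hsS, hS⟩ := exists_countable_elementarySubstructure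
    (L := Language.graph.sum strategyLanguage) hs
  let φ : Language.graph →ᴸ Language.graph.sum strategyLanguage := LHom.sumInl
  let := φ.reduct S
  let f : S ↪ₑ[Language.graph] M :=
    { toFun := (↑)
      map_formula' := fun n ψ x => by
        rw [← LHom.realize_onFormula φ, ← LHom.realize_onFormula φ]
        exact S.isElementary _ x }
  have hf : ∀ x y : S, edge S x y ↔ edge M (x : M) y := fun x y => by
    have := f.map_rel Language.adj ![x, y]
    rw [edge, ← this, edge, iff_iff_eq]
    congr 1
    funext i
    fin_cases i <;> rfl
  -- The strategy is part of the language, so `S` is closed under it.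
  have hclosed : ∀ (I : List S) (x : S), σ (I.map (↑)) x ∈ S := fun I x => by
    have := S.toSubstructure.fun_mem (Sum.inr () : (Language.graph.sum strategyLanguage).Functions
      (I.length + 1)) (Fin.cons (x : M) fun i => (I.get i : M))
      (fun i => Fin.cases x.2 (fun i => (I.get i).2) i)
    have hI : I.map (↑) = List.ofFn fun i => (I.get i : M) := by
      conv_lhs => rw [← List.ofFn_get I, List.map_ofFn]
      rfl
    rw [hI]
    exact this
  -- Moves are made in `S`, but survival is measured in `M`, so the strategy applies unchanged.
  obtain ⟨K, hK⟩ := exists_isKernel_of_game (edgeDigraph S)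
    (fun I => ∀ n, ¬ Lost (edge M) n {a | a ∈ I.map ((↑) : S → M)}) (by simpa using h0)
    (fun I x hI => by
      obtain ⟨h₁, h₂⟩ := hσ _ (x : M) hI
      refine ⟨⟨_, hclosed I x⟩, ?_, h₂⟩
      rcases h₁ with h₁ | h₁
      · exact Or.inl (Subtype.ext h₁)
      · exact Or.inr ((hf _ _).2 h₁))
    (fun I hI a ha b hb hab => hI 0
      ⟨a, List.mem_map_of_mem ha, b, List.mem_map_of_mem hb, (hf _ _).1 hab⟩)
  exact ⟨S, _, f, K, fun a ha => ⟨⟨a, hsS ha⟩, rfl⟩, hK⟩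

theorem edge_ultraproduct {ι : Type*} {w : Ultrafilter ι} {B : ι → Type u}
    [∀ i, Language.graph.Structure (B i)] [∀ i, Nonempty (B i)] (g h : ∀ i, B i) :
    edge ((w : Filter ι).Product B) (g : (w : Filter ι).Product B) h ↔
      ∀ᶠ i in w, edge (B i) (g i) (h i) := by
  have := Ultraproduct.realize_formula_cast (u := w)
    (show Language.graph.Formula (Fin 2) from
      adjFormula (d := 0) (.var (Sum.inl 0)) (.var (Sum.inl 1))) ![g, h]
  simp only [Formula.Realize, realize_adjFormula] at this
  exact this

/-- Being a kernel is a first-order property of the pair `(B i, K i)`, so the ultraproduct of the `K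
i` inherits it. The argument is the corresponding instance of Łoś's theorem. -/
theorem exists_isKernel_ultraproduct {ι : Type*} (w : Ultrafilter ι) {B : ι → Type u}
    [∀ i, Language.graph.Structure (B i)] [∀ i, Nonempty (B i)] (K : ∀ i, Set (B i))
    (hK : ∀ i, IsKernel (edgeDigraph (B i)) (K i)) :
    ∃ K' : Set ((w : Filter ι).Product B), IsKernel (edgeDigraph _) K' := by
  classical
  let K' : Set ((w : Filter ι).Product B) :=
    {q | ∃ g : ∀ i, B i, (g : (w : Filter ι).Product B) = q ∧ ∀ᶠ i in w, g i ∈ K i}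
  have hK' : ∀ g : ∀ i, B i, (g : (w : Filter ι).Product B) ∈ K' ↔ ∀ᶠ i in w, g i ∈ K i := by
    refine fun g => ⟨?_, fun h => ⟨g, rfl, h⟩⟩
    rintro ⟨g', he, h⟩
    have he' : ∀ᶠ i in w, g' i = g i := Quotient.exact he
    filter_upwards [h, he'] with i hi hi'
    exact hi' ▸ hi
  refine ⟨K', fun q => ?_⟩
  obtain ⟨g, rfl⟩ : ∃ g : ∀ i, B i, (g : (w : Filter ι).Product B) = q := Quotient.exists_rep q
  constructor
  · rintro hg q hq hqK
    obtain ⟨h, rfl⟩ : ∃ g : ∀ i, B i, (g : (w : Filter ι).Product B) = q := Quotient.exists_rep q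
    obtain ⟨i, h₁, h₂, h₃⟩ :=
      (((hK' g).1 hg).and (((hK' h).1 hqK).and ((edge_ultraproduct g h).1 hq))).exists
    exact (hK i _).1 h₁ _ h₃ h₂
  · intro H
    by_contra hg
    replace hg := Ultrafilter.eventually_not.2 ((hK' g).not.1 hg)
    have hex : ∀ i, ∃ b, g i ∉ K i → edge (B i) (g i) b ∧ b ∈ K i := fun i => by
      by_cases hi : g i ∈ K i
      · exact ⟨g i, fun h => (h hi).elim⟩
      · have hi' := hi
        rw [hK i] at hi'
        push Not at hi'
        obtain ⟨b, hb, hbK⟩ := hi'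
        exact ⟨b, fun _ => ⟨hb, hbK⟩⟩
    choose h hh using hex
    refine H (h : (w : Filter ι).Product B) ((edge_ultraproduct g h).2 ?_) ((hK' h).2 ?_)
    · filter_upwards [hg] with i hi using (hh i hi).1
    · filter_upwards [hg] with i hi using (hh i hi).2

/-- If the player can survive any number of rounds, then some elementary extension has
a kernel. -/
theorem exists_elementaryEmbedding_isKernel [Nonempty M] (h0 : ∀ n, ¬ Lost (edge M) n ∅) :
    ∃ (N : Type u) (_ : Language.graph.Structure N) (_ : M ↪ₑ[Language.graph] N) (K : Set N),
      IsKernel (edgeDigraph N) K := by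
  classical
  let U := ((hyperfilter ℕ : Ultrafilter ℕ) : Filter ℕ).Product fun _ => M
  have hU : HasGoodAnswers U := hasGoodAnswers_of_realize fun m a h =>
    exists_realize_ultraproduct (fun i => answerFormula m i) a h
  have hU0 : ∀ n, ¬ Lost (edge U) n ∅ := fun n => by
    have h₁ := realize_diagonal (hyperfilter ℕ)
      (show Language.graph.Formula (Fin 0) from lostFormula [] n 0) fun i => (i.elim0 : M)
    have h₂ := realize_lostFormula_nil n fun i => ((fun _ => i.elim0 : ℕ → M) : U)
    exact (h₂.symm.trans (h₁.trans (realize_lostFormula_nil n _))).not.2 (h0 n)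
  let j : M → U := fun v => ((fun _ => v : ℕ → M) : U)
  -- The extra point `j (Classical.arbitrary M)` makes `B S` nonempty even when `S` is empty.
  choose B str f K hf hK using fun S : Finset M =>
    exists_countable_elementaryEmbedding_isKernel hU hU0
      ((S.finite_toSet.image j).insert (j (Classical.arbitrary M))).countable
  have hne : ∀ S, Nonempty (B S) := fun S => by
    obtain ⟨b, -⟩ := hf S (Set.mem_insert _ _)
    exact ⟨b⟩
  -- Refining `atTop` ensures that each finite set of vertices is contained in almost every `S`. The
  -- values of `g v` at the sets `S` that miss `v` are therefore irrelevant.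
  let w : Ultrafilter (Finset M) := Ultrafilter.of atTop
  obtain ⟨K', hK'⟩ := exists_isKernel_ultraproduct w K hK
  have hex : ∀ (v : M) (S : Finset M), ∃ b : B S, v ∈ S → f S b = j v := fun v S => by
    by_cases hv : v ∈ S
    · obtain ⟨b, hb⟩ := hf S (Set.mem_insert_of_mem _ (Set.mem_image_of_mem j hv))
      exact ⟨b, fun _ => hb⟩
    · exact ⟨Classical.arbitrary _, fun h => (hv h).elim⟩
  choose g hg using hex
  refine ⟨(w : Filter (Finset M)).Product B, _,
    ⟨fun v => (g v : (w : Filter (Finset M)).Product B), fun n φ x => ?_⟩, K', hK'⟩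
  refine (Ultraproduct.realize_formula_cast (u := w) φ fun i => g (x i)).trans ?_
  have hev : ∀ᶠ S in w, (φ.Realize (fun i => g (x i) S) ↔ φ.Realize x) := by
    have : ∀ᶠ S in (w : Filter (Finset M)), Finset.univ.image x ≤ S :=
      Ultrafilter.of_le atTop (eventually_ge_atTop _)
    filter_upwards [this] with S hS
    -- Truth passes from `B S` to the ultrapower along `f S`, then to `M` along the diagonal
    -- embedding.
    rw [← (f S).map_formula]
    have : f S ∘ (fun i => g (x i) S) = fun i => j (x i) := funext fun i =>
      hg _ _ (hS (Finset.mem_image_of_mem x (Finset.mem_univ i)))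
    rw [this]
    exact realize_diagonal _ φ x
  rw [eventually_congr hev]
  exact eventually_const

end Game

/-! ### The resplendent case -/

section Resplendent

/-- The language with one unary relation symbol. -/
abbrev unaryLanguage : FirstOrder.Language.{0, 0} := relLanguage fun _ : Fin 1 => 1

/-- The unary relation symbol. -/
def unarySymbol : unaryLanguage.Relations 1 := ⟨0, rfl⟩

/-- The sentence saying that the unary relation symbol is interpreted by a kernel. -/
def kernelFormula (α : Type u) : (Language.graph.sum unaryLanguage).Formula α :=
  let A : (Language.graph.sum unaryLanguage).Relations 2 := LHom.sumInl.onRelation Language.adj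
  let U : (Language.graph.sum unaryLanguage).Relations 1 := LHom.sumInr.onRelation unarySymbol
  show BoundedFormula _ α 0 from
    ∀' ((U.boundedFormula₁ (&0)).iff
      (∀' ((A.boundedFormula₂ (&0) (&1)).imp (U.boundedFormula₁ (&1)).not)))

theorem realize_kernelFormula {α M : Type u} [Language.graph.Structure M]
    [unaryLanguage.Structure M] (v : α → M) :
    (kernelFormula α).Realize v ↔
      IsKernel (edgeDigraph M) {a | Structure.RelMap unarySymbol ![a]} := by
  simp only [kernelFormula, Formula.Realize, BoundedFormula.realize_all, BoundedFormula.realize_iff,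
    BoundedFormula.realize_imp, BoundedFormula.realize_not, BoundedFormula.realize_rel₁,
    BoundedFormula.realize_rel₂, LHom.map_onRelation]
  exact Iff.rfl

theorem exists_isKernel_of_resplendent {V : Type u} {G : Digraph V}
    (hG : HasLocalFiniteHeight G) (hr : Resplendent G) : ∃ K : Set V, IsKernel G K := by
  cases isEmpty_or_nonempty V with
  | inl h => exact ⟨∅, fun a => h.elim a⟩
  | inr h =>
    let := toStructure G
    obtain ⟨N, _, f, K, hK⟩ := exists_elementaryEmbedding_isKernel (M := V) (not_lost_empty hG)
    let : unaryLanguage.Structure N :=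
      { funMap := fun f => f.elim
        RelMap := fun {n} r => match n with
          | 1 => fun x => x 0 ∈ K
          | _ => fun _ => False }
    -- One new unary symbol suffices, and no parameter occurs in the sentence.
    obtain ⟨_, hV⟩ := hr 1 (fun _ => 1) (kernelFormula V)
      ⟨N, _, f, _, (realize_kernelFormula _).2 hK⟩
    exact ⟨_, (realize_kernelFormula _).1 hV⟩

end Resplendent

end DigraphKernel

theorem corollary4 {V : Type u} (G : Digraph V)
    (hG : DigraphKernel.HasLocalFiniteHeight G) :
    (DigraphKernel.Resplendent G → ∃ K : Set V, DigraphKernel.IsKernel G K) ∧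
    (Countable V → DigraphKernel.RecursivelySaturated G →
      ∃ K : Set V, DigraphKernel.IsKernel G K) :=
  ⟨DigraphKernel.exists_isKernel_of_resplendent hG,
    fun _ => DigraphKernel.exists_isKernel_of_recursivelySaturated hG⟩
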